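/- Let $I=(0,1]$ and let $\rho=(\rho_\varepsilon)_{\varepsilon\in I}$ be a gauge, i.e. a net in $(0,1]$ with $\rho_\varepsilon\to 0$ as $\varepsilon\to 0^+$; "for $\varepsilon$ small" means for all $\varepsilon\in(0,\varepsilon_0]$, for some $\varepsilon_0\in I$. A net $(x_\varepsilon)$ in $\mathbb C$ is moderate if $|x_\varepsilon|\le\rho_\varepsilon^{-N}$ for $\varepsilon$ small, for some $N\in\mathbb N$, and negligible if for every $q\in\mathbb N$ we have $|x_\varepsilon|\le\rho_\varepsilon^{q}$ for $\varepsilon$ small. Let ${}^\rho\widetilde{\mathbb C}$ (respectively ${}^\rho\widetilde{\mathbb R}$) be the ring of moderate nets of complex (respectively real) numbers modulo negligible ones, with classes $[x_\varepsilon]$ and modulus $|[x_\varepsilon]|=[|x_\varepsilon|]$. In ${}^\rho\widetilde{\mathbb R}$, $a\le b$ means that $a=[a_\varepsilon]$, $b=[b_\varepsilon]$ for some representatives with $a_\varepsilon\le b_\varepsilon$ for $\varepsilon$ small, and $a<b$ means that $a\le b$ and $b-a$ is invertible. For $r>0$ in ${}^\rho\widetilde{\mathbb R}$ put $B_r(z_0)=\{z\in{}^\rho\widetilde{\mathbb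 C}: |z-z_0|<r\}$; a set $U\subseteq{}^\rho\widetilde{\mathbb C}$ is sharply open if each of its points is the centre of such a ball contained in $U$. A subpoint $L\subseteq_0 I$ is a set $L\subseteq I$ with $0$ as an accumulation point, and $x|_L$ is the class of $(x_\varepsilon)_{\varepsilon\in L}$ in the ring ${}^\rho\widetilde{\mathbb C}|_L$ defined in the same way with indices $\varepsilon\in L$ only. A function $f:U\to{}^\rho\widetilde{\mathbb C}$ is a generalized holomorphic function (GHF) if there is a net of holomorphic functions $f_\varepsilon:\Omega_\varepsilon\to\mathbb C$ on open sets $\Omega_\varepsilon\subseteq\mathbb C$ such that, for every $z\in U$ and every representative $z=[z_\varepsilon]$: $z_\varepsilon\in\Omega_\varepsilon$ for $\varepsilon$ small, $(f_\varepsilon^{(n)}(z_\varepsilon))$ is moderate for every $n\in\mathbb N$, and $f(z)=[f_\varepsilon(z_\varepsilon)]$. On a sharply open set, its derivatives $f^{(n)}(z)=[f_\varepsilon^{(n)}(z_\varepsilon)]$ are well defined. Theorem. Let $U\subseteq{}^\rho\widetilde{\mathbb C}$ be sharply open, $z_0\in U$, and let $f:U\to{}^\rho\widetilde{\mathbb C}$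 be a GHF such that $f(z_0)=0$ and $f^{(n)}(z_0)\neq 0$ for some $n\in\mathbb N_{>0}$. Then there exist a subpoint $L\subseteq_0 I$ and $r\in{}^\rho\widetilde{\mathbb R}$, $r>0$, with $B_r(z_0)\subseteq U$, such that for every $z\in B_r(z_0)$ with $|z-z_0|>0$ the restriction $f(z)|_L$ is invertible in ${}^\rho\widetilde{\mathbb C}|_L$. -/

import Mathlib

open Filter

noncomputable section

namespace RobinsonColombeau

/-- The index set `I = (0, 1]`. The relation "for `ε ∈ I` sufficiently small" is
`∀ᶠ ε in atBot`, since `I` has no least element. -/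
abbrev Idx : Type := Set.Ioc (0 : ℝ) 1

/-- A gauge: a net `ρ : I → (0, 1]` with `ρ_ε → 0` as `ε → 0⁺`. -/
structure Gauge where
  toFun : Idx → ℝ
  pos : ∀ ε, 0 < toFun ε
  le_one : ∀ ε, toFun ε ≤ 1
  tendsto_zero : Tendsto toFun atBot (nhds 0)

instance : CoeFun Gauge (fun _ => Idx → ℝ) := ⟨Gauge.toFun⟩

/-- `L ⊆₀ I`: the set `L ⊆ I` has `0` as an accumulation point, i.e. it contains
arbitrarily small `ε`. -/
def IsSubpoint (L : Set Idx) : Prop := ∃ᶠ ε in atBot, ε ∈ L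

/-- `ρ`-moderate nets, tested only for `ε ∈ S` (for `S = univ`: the usual ones). -/
def IsModerate {𝕜 : Type} [NormedField 𝕜] (ρ : Gauge) (S : Set Idx) (x : Idx → 𝕜) : Prop :=
  ∃ N : ℕ, ∀ᶠ ε in atBot, ε ∈ S → ‖x ε‖ ≤ (ρ ε ^ N)⁻¹

/-- `ρ`-negligible nets, tested only for `ε ∈ S` (for `S = univ`: the usual ones). -/
def IsNegligible {𝕜 : Type} [NormedField 𝕜] (ρ : Gauge) (S : Set Idx) (x : Idx → 𝕜) : Prop :=
  ∀ q : ℕ, ∀ᶠ ε in atBot, ε ∈ S → ‖x ε‖ ≤ ρ ε ^ q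

section Algebra

variable {𝕜 : Type} [NormedField 𝕜] {ρ : Gauge} {S : Set Idx} {x y : Idx → 𝕜}

theorem Gauge.eventually_le_half (ρ : Gauge) : ∀ᶠ ε in atBot, ρ ε ≤ 1 / 2 :=
  ρ.tendsto_zero.eventually_le_const (by norm_num)

theorem IsModerate.add (hx : IsModerate ρ S x) (hy : IsModerate ρ S y) :
    IsModerate ρ S (x + y) := by
  obtain ⟨N, hN⟩ := hx
  obtain ⟨M, hM⟩ := hy
  refine ⟨N + M + 1, ?_⟩
  filter_upwards [hN, hM, ρ.eventually_le_half] with ε h1 h2 h3 hS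
  have hp := ρ.pos ε
  have hA : (ρ ε ^ N)⁻¹ ≤ (ρ ε ^ (N + M))⁻¹ :=
    inv_anti₀ (pow_pos hp _) (pow_le_pow_of_le_one hp.le (ρ.le_one ε) (by omega))
  have hB : (ρ ε ^ M)⁻¹ ≤ (ρ ε ^ (N + M))⁻¹ :=
    inv_anti₀ (pow_pos hp _) (pow_le_pow_of_le_one hp.le (ρ.le_one ε) (by omega))
  have hC : (2 : ℝ) ≤ (ρ ε)⁻¹ := by
    rw [le_inv_comm₀ (by norm_num) hp]; linarith
  have hD : 0 < (ρ ε ^ (N + M))⁻¹ := by positivity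
  calc ‖(x + y) ε‖ ≤ ‖x ε‖ + ‖y ε‖ := norm_add_le _ _
    _ ≤ (ρ ε ^ (N + M))⁻¹ * 2 := by linarith [h1 hS, h2 hS]
    _ ≤ (ρ ε ^ (N + M))⁻¹ * (ρ ε)⁻¹ := by gcongr
    _ = (ρ ε ^ (N + M + 1))⁻¹ := by rw [pow_succ, mul_inv]

theorem IsModerate.mul (hx : IsModerate ρ S x) (hy : IsModerate ρ S y) :
    IsModerate ρ S (x * y) := by
  obtain ⟨N, hN⟩ := hx
  obtain ⟨M, hM⟩ := hy
  refine ⟨N + M, ?_⟩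
  filter_upwards [hN, hM] with ε h1 h2 hS
  have hp := ρ.pos ε
  rw [Pi.mul_apply, norm_mul, pow_add, mul_inv]
  exact mul_le_mul (h1 hS) (h2 hS) (norm_nonneg _) (by positivity)

theorem IsNegligible.add (hx : IsNegligible ρ S x) (hy : IsNegligible ρ S y) :
    IsNegligible ρ S (x + y) := by
  intro q
  filter_upwards [hx (q + 1), hy (q + 1), ρ.eventually_le_half] with ε h1 h2 h3 hS
  have hp := pow_pos (ρ.pos ε) q
  calc ‖(x + y) ε‖ ≤ ‖x ε‖ + ‖y ε‖ := norm_add_le _ _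
    _ ≤ 2 * (ρ ε ^ q * ρ ε) := by rw [← pow_succ]; linarith [h1 hS, h2 hS]
    _ ≤ ρ ε ^ q := by nlinarith

theorem IsModerate.mul_negligible (hx : IsModerate ρ S x) (hy : IsNegligible ρ S y) :
    IsNegligible ρ S (x * y) := by
  obtain ⟨N, hN⟩ := hx
  intro q
  filter_upwards [hN, hy (q + N)] with ε h1 h2 hS
  have hp := pow_pos (ρ.pos ε) N
  rw [Pi.mul_apply, norm_mul]
  calc ‖x ε‖ * ‖y ε‖ ≤ (ρ ε ^ N)⁻¹ * ρ ε ^ (q + N) :=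
        mul_le_mul (h1 hS) (h2 hS) (norm_nonneg _) (by positivity)
    _ = ρ ε ^ q := by rw [pow_add]; field_simp

variable (𝕜 ρ S)

/-- The ring of `ρ`-moderate nets. -/
def moderateNets : Subring (Idx → 𝕜) where
  carrier := {x | IsModerate ρ S x}
  mul_mem' := IsModerate.mul
  one_mem' := ⟨0, by simp⟩
  add_mem' := IsModerate.add
  zero_mem' := ⟨0, by simp⟩
  neg_mem' := by
    rintro x ⟨N, hN⟩
    exact ⟨N, by simpa using hN⟩

/-- The ideal of `ρ`-negligible nets. -/
def negligibleNets : Ideal (moderateNets 𝕜 ρ S) where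
  carrier := {x | IsNegligible ρ S (x : Idx → 𝕜)}
  add_mem' := IsNegligible.add
  zero_mem' := fun q => Eventually.of_forall fun ε _ => by
    simpa using (pow_pos (ρ.pos ε) q).le
  smul_mem' := fun c _ hx => IsModerate.mul_negligible c.2 hx

/-- The ring of generalized numbers restricted to `S`: moderate nets modulo negligible nets,
where only the indices `ε ∈ S` matter. For `S = univ` this is the full ring of
Robinson-Colombeau generalized numbers. -/
def GenNum : Type := moderateNets 𝕜 ρ S ⧸ negligibleNets 𝕜 ρ S

instance : CommRing (GenNum 𝕜 ρ S) :=
  inferInstanceAs (CommRing (moderateNets 𝕜 ρ S ⧸ negligibleNets 𝕜 ρ S))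

variable {𝕜 ρ S}

/-- The class `[x_ε]` of a moderate net. -/
def GenNum.mk (x : moderateNets 𝕜 ρ S) : GenNum 𝕜 ρ S :=
  Ideal.Quotient.mk (negligibleNets 𝕜 ρ S) x

/-- `x = (x_ε)` is a representative of the generalized number `a`, i.e. `a = [x_ε]`. -/
def IsRep (x : Idx → 𝕜) (a : GenNum 𝕜 ρ S) : Prop :=
  ∃ hx : x ∈ moderateNets 𝕜 ρ S, GenNum.mk ⟨x, hx⟩ = a

theorem exists_isRep (a : GenNum 𝕜 ρ S) : ∃ x : Idx → 𝕜, IsRep x a := by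
  obtain ⟨x, hx⟩ := Ideal.Quotient.mk_surjective a
  exact ⟨x, x.2, hx⟩

/-- The restriction `a ↦ a|_L` of generalized numbers to `L ⊆ I`, `[x_ε] ↦ [(x_ε)_{ε ∈ L}]`. -/
def GenNum.restrict (L : Set Idx) : GenNum 𝕜 ρ Set.univ →+* GenNum 𝕜 ρ L :=
  Ideal.quotientMap (negligibleNets 𝕜 ρ L)
    (Subring.inclusion (S := moderateNets 𝕜 ρ Set.univ) (T := moderateNets 𝕜 ρ L)
      fun _ ⟨N, hN⟩ => ⟨N, hN.mono fun _ h _ => h (Set.mem_univ _)⟩)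
    fun _ hx q => (hx q).mono fun _ h _ => h (Set.mem_univ _)

/-- The modulus `|[x_ε]| = [|x_ε|]`. -/
def GenNum.abs (a : GenNum 𝕜 ρ S) : GenNum ℝ ρ S :=
  Quotient.liftOn' a
    (fun x => GenNum.mk ⟨fun ε => ‖(x : Idx → 𝕜) ε‖, by
      obtain ⟨N, hN⟩ := x.2
      exact ⟨N, by simpa using hN⟩⟩)
    (by
      intro x y hxy
      have h : x - y ∈ negligibleNets 𝕜 ρ S := (Submodule.quotientRel_def _).1 hxy
      refine Ideal.Quotient.eq.2 ?_
      intro q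
      filter_upwards [h q] with ε hε hS
      exact (abs_norm_sub_norm_le _ _).trans (hε hS))

/-- `[x_ε] ≤ [y_ε]` iff `x_ε ≤ y_ε` for `ε` small, for suitable representatives. -/
instance : LE (GenNum ℝ ρ S) :=
  ⟨fun a b => ∃ x y : Idx → ℝ, IsRep x a ∧ IsRep y b ∧ ∀ᶠ ε in atBot, ε ∈ S → x ε ≤ y ε⟩

/-- `a < b` iff `a ≤ b` and `b - a` is invertible. -/
instance : LT (GenNum ℝ ρ S) := ⟨fun a b => a ≤ b ∧ IsUnit (b - a)⟩

end Algebra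

/-- The ring of real Robinson-Colombeau generalized numbers. -/
abbrev RCReal (ρ : Gauge) : Type := GenNum ℝ ρ Set.univ

/-- The ring of complex Robinson-Colombeau generalized numbers. -/
abbrev RCComplex (ρ : Gauge) : Type := GenNum ℂ ρ Set.univ

/-- The sharp ball `B_r(z₀) = {z : |z - z₀| < r}`. -/
def sharpBall {ρ : Gauge} (z₀ : RCComplex ρ) (r : RCReal ρ) : Set (RCComplex ρ) :=
  {z | (z - z₀).abs < r}

/-- Openness in the sharp topology, which is generated by the balls of generalized radius
`r > 0`. -/
def IsSharplyOpen {ρ : Gauge} (U : Set (RCComplex ρ)) : Prop :=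
  ∀ z ∈ U, ∃ r : RCReal ρ, 0 < r ∧ sharpBall z r ⊆ U

/-- The net `(F_ε)` of holomorphic functions `F_ε : Ω_ε → ℂ` defines `f : U → RCComplex ρ`:
`U` lies in the strongly internal set of `(Ω_ε)` (each representative `(c_ε)` of each `z ∈ U`
satisfies `c_ε ∈ Ω_ε` for `ε` small), all nets of derivatives are moderate at the points of `U`,
and `f [c_ε] = [F_ε(c_ε)]`. The values of `F_ε` outside of `Ω_ε` are irrelevant. -/
structure IsDefiningNet {ρ : Gauge} {U : Set (RCComplex ρ)} (f : U → RCComplex ρ)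
    (Ω : Idx → Set ℂ) (F : Idx → ℂ → ℂ) : Prop where
  isOpen : ∀ ε, IsOpen (Ω ε)
  holomorphic : ∀ ε, DifferentiableOn ℂ (F ε) (Ω ε)
  mem : ∀ z : U, ∀ c : Idx → ℂ, IsRep c (z : RCComplex ρ) → ∀ᶠ ε in atBot, c ε ∈ Ω ε
  moderate : ∀ z : U, ∀ c : Idx → ℂ, IsRep c (z : RCComplex ρ) → ∀ n : ℕ,
    IsModerate ρ Set.univ fun ε => iteratedDeriv n (F ε) (c ε)
  value : ∀ z : U, ∀ c : Idx → ℂ, IsRep c (z : RCComplex ρ) →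
    IsRep (fun ε => F ε (c ε)) (f z)

/-- Generalized holomorphic functions on `U`. -/
def IsGHF {ρ : Gauge} {U : Set (RCComplex ρ)} (f : U → RCComplex ρ) : Prop :=
  ∃ (Ω : Idx → Set ℂ) (F : Idx → ℂ → ℂ), IsDefiningNet f Ω F

/-- The `n`-th derivative `f⁽ⁿ⁾(z) = [F_ε⁽ⁿ⁾(c_ε)]` of a generalized holomorphic function
`f = [F_ε(-)]` at `z = [c_ε]`. On sharply open sets it does not depend on the defining net
nor on the representative of `z`. -/
def IsGHF.iteratedDeriv {ρ : Gauge} {U : Set (RCComplex ρ)} {f : U → RCComplex ρ}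
    (hf : IsGHF f) (n : ℕ) (z : U) : RCComplex ρ :=
  GenNum.mk ⟨fun ε => _root_.iteratedDeriv n (hf.choose_spec.choose ε)
      ((exists_isRep (z : RCComplex ρ)).choose ε),
    hf.choose_spec.choose_spec.moderate z _ (exists_isRep (z : RCComplex ρ)).choose_spec n⟩

section WellDefined

variable {ρ : Gauge}

theorem isRep_add {𝕜 : Type} [NormedField 𝕜] {S : Set Idx} {x y : Idx → 𝕜}
    {a b : GenNum 𝕜 ρ S} (hx : IsRep x a) (hy : IsRep y b) : IsRep (x + y) (a + b) := by
  obtain ⟨hx, rfl⟩ := hx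
  obtain ⟨hy, rfl⟩ := hy
  exact ⟨Subring.add_mem _ hx hy, rfl⟩

theorem isRep_sub {𝕜 : Type} [NormedField 𝕜] {S : Set Idx} {x y : Idx → 𝕜}
    {a b : GenNum 𝕜 ρ S} (hx : IsRep x a) (hy : IsRep y b) : IsRep (x - y) (a - b) := by
  obtain ⟨hx, rfl⟩ := hx
  obtain ⟨hy, rfl⟩ := hy
  exact ⟨Subring.sub_mem _ hx hy, rfl⟩

theorem isRep_mul {𝕜 : Type} [NormedField 𝕜] {S : Set Idx} {x y : Idx → 𝕜}
    {a b : GenNum 𝕜 ρ S} (hx : IsRep x a) (hy : IsRep y b) : IsRep (x * y) (a * b) := by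
  obtain ⟨hx, rfl⟩ := hx
  obtain ⟨hy, rfl⟩ := hy
  exact ⟨Subring.mul_mem _ hx hy, rfl⟩

theorem isRep_one {𝕜 : Type} [NormedField 𝕜] {S : Set Idx} :
    IsRep (1 : Idx → 𝕜) (1 : GenNum 𝕜 ρ S) := ⟨Subring.one_mem _, rfl⟩

theorem isRep_zero {𝕜 : Type} [NormedField 𝕜] {S : Set Idx} :
    IsRep (0 : Idx → 𝕜) (0 : GenNum 𝕜 ρ S) := ⟨Subring.zero_mem _, rfl⟩

theorem IsRep.abs {𝕜 : Type} [NormedField 𝕜] {S : Set Idx} {x : Idx → 𝕜}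
    {a : GenNum 𝕜 ρ S} (hx : IsRep x a) : IsRep (fun ε => ‖x ε‖) a.abs := by
  obtain ⟨hx, rfl⟩ := hx
  obtain ⟨N, hN⟩ := id hx
  exact ⟨⟨N, by simpa using hN⟩, rfl⟩

theorem IsRep.negligible_sub {𝕜 : Type} [NormedField 𝕜] {S : Set Idx} {x y : Idx → 𝕜}
    {a : GenNum 𝕜 ρ S} (hx : IsRep x a) (hy : IsRep y a) : IsNegligible ρ S (x - y) := by
  obtain ⟨hx, rfl⟩ := hx
  obtain ⟨hy, h⟩ := hy
  exact Ideal.Quotient.eq.1 h.symm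

theorem IsRep.of_negligible_sub {𝕜 : Type} [NormedField 𝕜] {S : Set Idx} {x y : Idx → 𝕜}
    {a : GenNum 𝕜 ρ S} (hx : IsRep x a) (hy : y ∈ moderateNets 𝕜 ρ S)
    (h : IsNegligible ρ S (x - y)) : IsRep y a := by
  obtain ⟨hx, rfl⟩ := hx
  exact ⟨hy, (Ideal.Quotient.eq.2 (show (⟨x, hx⟩ : moderateNets 𝕜 ρ S) - ⟨y, hy⟩ ∈ _ from h)).symm⟩

/-- A generalized number with a representative bounded below by a power of `ρ` on `S` is
invertible. -/
theorem IsRep.isUnit {𝕜 : Type} [NormedField 𝕜] {S : Set Idx} {x : Idx → 𝕜}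
    {a : GenNum 𝕜 ρ S} (hx : IsRep x a) {q : ℕ}
    (h : ∀ᶠ ε in atBot, ε ∈ S → ρ ε ^ q ≤ ‖x ε‖) : IsUnit a := by
  have hi : IsModerate ρ S x⁻¹ := by
    refine ⟨q, h.mono fun ε hε hS => ?_⟩
    rw [Pi.inv_apply, norm_inv]
    exact inv_anti₀ (pow_pos (ρ.pos ε) q) (hε hS)
  refine IsUnit.of_mul_eq_one (GenNum.mk ⟨x⁻¹, hi⟩) ?_
  have h1 : IsRep (x * x⁻¹) (a * GenNum.mk ⟨x⁻¹, hi⟩) := isRep_mul hx ⟨hi, rfl⟩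
  obtain ⟨hm, he⟩ := h1.of_negligible_sub isRep_one.1 (by
    intro k
    filter_upwards [h] with ε hε hS
    have : x ε ≠ 0 := norm_pos_iff.1 ((pow_pos (ρ.pos ε) q).trans_le (hε hS))
    simp [this, (pow_pos (ρ.pos ε) k).le])
  exact he.symm

theorem IsRep.lower_bound {𝕜 : Type} [NormedField 𝕜] {S : Set Idx} {x : Idx → 𝕜}
    {a : GenNum 𝕜 ρ S} (hx : IsRep x a) (ha : IsUnit a) :
    ∃ q : ℕ, ∀ᶠ ε in atBot, ε ∈ S → ρ ε ^ q ≤ ‖x ε‖ := by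
  obtain ⟨b, hb⟩ := ha.exists_right_inv
  obtain ⟨y, hy⟩ := exists_isRep b
  have h1 := (isRep_mul hx hy).negligible_sub (hb ▸ isRep_one) 1
  obtain ⟨N, hN⟩ := hy.1
  refine ⟨N + 1, ?_⟩
  filter_upwards [h1, hN, ρ.eventually_le_half] with ε h1 h2 h3 hS
  have h1 := h1 hS
  have h2 := h2 hS
  have hp := pow_pos (ρ.pos ε) N
  simp only [Pi.sub_apply, Pi.mul_apply, Pi.one_apply, pow_one] at h1
  have h4 : (1 : ℝ) - ‖x ε‖ * ‖y ε‖ ≤ ρ ε := by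
    have := norm_sub_norm_le (1 : 𝕜) (x ε * y ε)
    rw [norm_one, norm_mul, norm_sub_rev] at this
    linarith
  have h5 : ‖x ε‖ * ‖y ε‖ ≤ ‖x ε‖ * (ρ ε ^ N)⁻¹ := by gcongr
  have h6 : 1 / 2 ≤ ‖x ε‖ * (ρ ε ^ N)⁻¹ := by linarith
  have h7 : 1 / 2 * ρ ε ^ N ≤ ‖x ε‖ := by
    calc 1 / 2 * ρ ε ^ N ≤ ‖x ε‖ * (ρ ε ^ N)⁻¹ * ρ ε ^ N := by gcongr
      _ = ‖x ε‖ := by field_simp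
  rw [pow_succ]
  nlinarith

theorem IsRep.pos_lower_bound {x : Idx → ℝ} {r : RCReal ρ} (hx : IsRep x r) (hr : 0 < r) :
    ∃ q : ℕ, ∀ᶠ ε in atBot, ρ ε ^ q ≤ x ε := by
  obtain ⟨⟨a, b, ha, hb, hab⟩, hu⟩ := hr
  rw [sub_zero] at hu
  obtain ⟨q, hq⟩ := hx.lower_bound hu
  refine ⟨q, ?_⟩
  filter_upwards [hq, hab, ha.negligible_sub isRep_zero (q + 2),
    hx.negligible_sub hb (q + 2), ρ.eventually_le_half] with ε h1 h2 h3 h4 h5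
  have h1 := h1 trivial
  have h2 := h2 trivial
  have h3 := h3 trivial
  have h4 := h4 trivial
  have hp := pow_pos (ρ.pos ε) q
  simp only [Pi.sub_apply, Pi.zero_apply, sub_zero, Real.norm_eq_abs, abs_le] at h1 h3 h4
  have h6 : ρ ε ^ (q + 2) ≤ 1 / 4 * ρ ε ^ q := by
    have h7 : ρ ε ^ 2 ≤ 1 / 4 := by nlinarith [ρ.pos ε]
    rw [pow_add]; nlinarith
  rcases le_abs.1 h1 with h | h <;> linarith

/-- Around a point of a sharply open set, whatever holds (for small `ε`) along all
representatives of all points holds uniformly on balls of radius `ρ_ε ^ q`. -/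
theorem IsSharplyOpen.uniform {U : Set (RCComplex ρ)} (hU : IsSharplyOpen U)
    {z : RCComplex ρ} (hz : z ∈ U) {c : Idx → ℂ} (hc : IsRep c z) :
    ∃ q : ℕ, ∀ P : Idx → ℂ → Prop,
      (∀ w ∈ U, ∀ d : Idx → ℂ, IsRep d w → ∀ᶠ ε in atBot, P ε (d ε)) →
        ∀ᶠ ε in atBot, ∀ w : ℂ, ‖w - c ε‖ ≤ ρ ε ^ q → P ε w := by
  obtain ⟨r, hr, hrU⟩ := hU z hz
  obtain ⟨x, hx⟩ := exists_isRep r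
  obtain ⟨q, hq⟩ := hx.pos_lower_bound hr
  refine ⟨q + 1, fun P hP => ?_⟩
  classical
  let d : Idx → ℂ := fun ε =>
    if h : ∃ w : ℂ, ‖w - c ε‖ ≤ ρ ε ^ (q + 1) ∧ ¬ P ε w then h.choose else c ε
  have hd : ∀ ε, ‖d ε - c ε‖ ≤ ρ ε ^ (q + 1) := by
    intro ε
    by_cases h : ∃ w : ℂ, ‖w - c ε‖ ≤ ρ ε ^ (q + 1) ∧ ¬ P ε w
    · simp only [d, dif_pos h]; exact h.choose_spec.1
    · simp only [d, dif_neg h, sub_self, norm_zero]; exact (pow_pos (ρ.pos ε) _).le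
  have hdc : IsModerate ρ Set.univ (d - c) := by
    refine ⟨0, Eventually.of_forall fun ε _ => ?_⟩
    simpa using (hd ε).trans (pow_le_one₀ (ρ.pos ε).le (ρ.le_one ε))
  have hdm : IsModerate ρ Set.univ d := by simpa using hdc.add hc.1
  have hdU : GenNum.mk ⟨d, hdm⟩ ∈ U := by
    apply hrU
    have h1 : IsRep (fun ε => ‖(d - c) ε‖) (GenNum.mk ⟨d, hdm⟩ - z).abs :=
      (isRep_sub ⟨hdm, rfl⟩ hc).abs
    refine ⟨⟨_, _, h1, hx, ?_⟩, (isRep_sub hx h1).isUnit (q := q + 1) ?_⟩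
    · filter_upwards [hq] with ε h _
      exact (hd ε).trans ((pow_le_pow_of_le_one (ρ.pos ε).le (ρ.le_one ε) (by omega)).trans h)
    · filter_upwards [hq, ρ.eventually_le_half] with ε h h' _
      have h2 : ‖(d - c) ε‖ ≤ ρ ε ^ (q + 1) := hd ε
      refine le_trans ?_ (le_abs_self _)
      have hp := pow_pos (ρ.pos ε) q
      rw [pow_succ] at h2 ⊢
      simp only [Pi.sub_apply] at h2 ⊢
      nlinarith
  filter_upwards [hP _ hdU d ⟨hdm, rfl⟩] with ε hε w hw
  by_contra hPw
  have h : ∃ w : ℂ, ‖w - c ε‖ ≤ ρ ε ^ (q + 1) ∧ ¬ P ε w := ⟨w, hw, hPw⟩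
  have := h.choose_spec.2
  simp only [d, dif_pos h] at hε
  exact this hε

/-- The derivatives of a generalized holomorphic function are well defined. -/
theorem IsGHF.isRep_iteratedDeriv {U : Set (RCComplex ρ)} (hU : IsSharplyOpen U)
    {f : U → RCComplex ρ} (hf : IsGHF f) {Ω : Idx → Set ℂ} {F : Idx → ℂ → ℂ}
    (hF : IsDefiningNet f Ω F) (n : ℕ) (z : U) {c : Idx → ℂ}
    (hc : IsRep c (z : RCComplex ρ)) :
    IsRep (fun ε => _root_.iteratedDeriv n (F ε) (c ε)) (hf.iteratedDeriv n z) := by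
  set Ω' := hf.choose with hΩ'
  set G := hf.choose_spec.choose with hG'
  have hG : IsDefiningNet f Ω' G := hf.choose_spec.choose_spec
  set c' := (exists_isRep (z : RCComplex ρ)).choose with hc''
  have hc' : IsRep c' (z : RCComplex ρ) := (exists_isRep (z : RCComplex ρ)).choose_spec
  have key : IsRep (fun ε => _root_.iteratedDeriv n (G ε) (c' ε)) (hf.iteratedDeriv n z) :=
    ⟨_, rfl⟩
  refine key.of_negligible_sub (hF.moderate z c hc n) ?_
  obtain ⟨q, hq⟩ := hU.uniform z.2 hc
  have hshift : ∀ w ∈ U, ∀ d : Idx → ℂ, IsRep d w → IsRep (d + (c' - c)) w := by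
    intro w _ d hd
    simpa using isRep_add hd (isRep_sub hc' hc)
  have hdom := hq (fun ε w => w ∈ Ω ε ∧ w + (c' ε - c ε) ∈ Ω' ε) (fun w hw d hd =>
    (hF.mem ⟨w, hw⟩ d hd).and (hG.mem ⟨w, hw⟩ _ (hshift w hw d hd)))
  have hneg : ∀ k : ℕ, ∀ᶠ ε in atBot, ∀ w : ℂ, ‖w - c ε‖ ≤ ρ ε ^ q →
      ‖G ε (w + (c' ε - c ε)) - F ε w‖ ≤ ρ ε ^ k := fun k => hq _ (fun w hw d hd =>
    ((hG.value ⟨w, hw⟩ _ (hshift w hw d hd)).negligible_sub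
      (hF.value ⟨w, hw⟩ d hd) k).mono fun ε h => h trivial)
  intro k
  have hfac : ∀ᶠ ε in atBot, (n.factorial : ℝ) * ρ ε ≤ 1 := by
    have : Tendsto (fun ε => (n.factorial : ℝ) * ρ ε) atBot (nhds (n.factorial * 0)) :=
      ρ.tendsto_zero.const_mul _
    exact this.eventually_le_const (by simp)
  filter_upwards [hdom, hneg (k + 1 + q * n), hfac] with ε h1 h2 h3 _
  have hp := pow_pos (ρ.pos ε) q
  set H : ℂ → ℂ := fun w => G ε (w + (c' ε - c ε)) - F ε w with hH
  have hO : IsOpen {w : ℂ | w + (c' ε - c ε) ∈ Ω' ε} :=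
    (hG.isOpen ε).preimage (by fun_prop)
  have hdiffG : DifferentiableOn ℂ (fun w => G ε (w + (c' ε - c ε)))
      {w : ℂ | w + (c' ε - c ε) ∈ Ω' ε} :=
    (hG.holomorphic ε).comp (by fun_prop) (fun w hw => hw)
  have hc0 := h1 (c ε) (by simpa using hp.le)
  have hder : _root_.iteratedDeriv n H (c ε)
      = _root_.iteratedDeriv n (G ε) (c' ε) - _root_.iteratedDeriv n (F ε) (c ε) := by
    have hA : ContDiffAt ℂ n (fun w => G ε (w + (c' ε - c ε))) (c ε) :=
      (hdiffG.analyticAt (hO.mem_nhds hc0.2)).contDiffAt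
    have hB : ContDiffAt ℂ n (F ε) (c ε) :=
      ((hF.holomorphic ε).analyticAt ((hF.isOpen ε).mem_nhds hc0.1)).contDiffAt
    have := iteratedDeriv_sub hA hB
    rw [show H = (fun w => G ε (w + (c' ε - c ε))) - F ε from rfl, this,
      iteratedDeriv_comp_add_const]
    simp
  have hHd : DiffContOnCl ℂ H (Metric.ball (c ε) (ρ ε ^ q)) := by
    refine DifferentiableOn.diffContOnCl (DifferentiableOn.mono
      (t := {w : ℂ | w + (c' ε - c ε) ∈ Ω' ε} ∩ Ω ε) ?_ ?_)
    · exact (hdiffG.mono Set.inter_subset_left).sub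
        ((hF.holomorphic ε).mono Set.inter_subset_right)
    · rw [closure_ball _ hp.ne']
      intro w hw
      have := h1 w (by simpa [dist_eq_norm] using hw)
      exact ⟨this.2, this.1⟩
  have hcauchy := Complex.norm_iteratedDeriv_le_of_forall_mem_sphere_norm_le n hp hHd
    (C := ρ ε ^ (k + 1 + q * n)) (fun w hw => h2 w (by
      simpa [dist_eq_norm] using (Metric.mem_sphere.1 hw).le))
  rw [hder] at hcauchy
  refine hcauchy.trans ?_
  have hpk := pow_pos (ρ.pos ε) k
  rw [← pow_mul, pow_add, mul_div_assoc, mul_div_assoc, div_self (pow_pos (ρ.pos ε) _).ne',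
    mul_one, pow_succ]
  nlinarith

end WellDefined

end RobinsonColombeau

end

/-! Let `n` be the least positive order with `f⁽ⁿ⁾(z₀) ≠ 0`. In a ring with zero divisors, nonzero
does not mean invertible. It only says that the net `F_ε⁽ⁿ⁾(c_ε)` is not negligible, hence at least
`ρ_ε ^ p` for some `p` and arbitrarily small `ε`; these `ε` form `L`. The Taylor coefficients of
order below `n` are negligible. For `ε ∈ L` the expansion at `c_ε` is thus a dominant term of order
`n`, a negligible part and a remainder.

`IsDefiningNet.exists_uniform_bound` bounds `F_ε` by `ρ_ε ^ (-N)` on discs of radius `ρ_ε ^ q`, so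
by Cauchy's estimates (`norm_taylor_sub_le`) the remainder is at most half the dominant term once
`|w - c_ε|` is below a fixed power of `ρ_ε`, which gives `r`. This leaves the lower bound of
`le_norm_of_le_norm_iteratedDeriv`. If `|z - z₀| > 0`, then `|z - z₀| ≥ ρ ^ m` for some `m`
depending on `z`. The negligible part is smaller than every power of `ρ`, so it loses for each `m`,
and neither `L` nor `r` depends on `z`. -/

namespace RobinsonColombeau

/-! ### Taylor remainders from Cauchy's estimates -/

section Analysis

/-- Remainder estimate for the Taylor expansion of a bounded holomorphic function. -/
theorem norm_taylor_sub_le {F : ℂ → ℂ} {Ω : Set ℂ} (hF : DifferentiableOn ℂ F Ω)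
    {c : ℂ} {s M : ℝ} (hs : 0 < s) (hΩ : Metric.closedBall c s ⊆ Ω)
    (hM : ∀ w ∈ Metric.closedBall c s, ‖F w‖ ≤ M) {w : ℂ} (hw : ‖w - c‖ / s ≤ 1 / 2) (n : ℕ) :
    ‖∑ k ∈ Finset.range n, (k.factorial : ℂ)⁻¹ * (w - c) ^ k * iteratedDeriv k F c - F w‖
      ≤ 2 * M * (‖w - c‖ / s) ^ n := by
  have hd : DifferentiableOn ℂ F (Metric.closedBall c s) := hF.mono hΩ
  have hM0 : 0 ≤ M := (norm_nonneg _).trans (hM c (Metric.mem_closedBall_self hs.le))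
  have hwb : w ∈ Metric.ball c s := by
    rw [Metric.mem_ball, dist_eq_norm]
    rw [div_le_iff₀ hs] at hw
    linarith
  have hsum := Complex.hasSum_taylorSeries_on_ball
    (hd.mono Metric.ball_subset_closedBall) hwb
  simp only [smul_eq_mul] at hsum
  have hcl : DiffContOnCl ℂ F (Metric.ball c s) := by
    refine DifferentiableOn.diffContOnCl ?_
    rwa [closure_ball _ hs.ne']
  have hterm : ∀ k, ‖(k.factorial : ℂ)⁻¹ * (w - c) ^ k * iteratedDeriv k F c‖
      ≤ M * (‖w - c‖ / s) ^ k := by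
    intro k
    have h := Complex.norm_iteratedDeriv_le_of_forall_mem_sphere_norm_le k hs hcl
      (fun z hz => hM z (Metric.sphere_subset_closedBall hz))
    have hk : (0 : ℝ) < k.factorial := by positivity
    rw [norm_mul, norm_mul, norm_inv, norm_pow, Complex.norm_natCast]
    calc (k.factorial : ℝ)⁻¹ * ‖w - c‖ ^ k * ‖iteratedDeriv k F c‖
        ≤ (k.factorial : ℝ)⁻¹ * ‖w - c‖ ^ k * (k.factorial * M / s ^ k) := by gcongr
      _ = M * (‖w - c‖ / s) ^ k := by rw [div_pow]; field_simp
  have hr : ‖w - c‖ / s < 1 := by linarith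
  refine (norm_sub_le_of_geometric_bound_of_hasSum hr hterm
    (by simpa [mul_assoc] using hsum) n).trans ?_
  -- The geometric tail carries `1 / (1 - ‖w - c‖ / s)`, which is at most `2`.
  rw [div_le_iff₀ (by linarith)]
  have : 0 ≤ M * (‖w - c‖ / s) ^ n := by positivity
  nlinarith

end Analysis

/-! ### Generalized numbers, sharp balls and uniform bounds for nets -/

section Nets

variable {ρ : Gauge}

theorem Gauge.eventually_const_mul_le_one (ρ : Gauge) (C : ℝ) :
    ∀ᶠ ε in atBot, C * ρ ε ≤ 1 := by
  have : Tendsto (fun ε => C * ρ ε) atBot (nhds (C * 0)) := ρ.tendsto_zero.const_mul _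
  exact this.eventually_le_const (by simp)

theorem Gauge.pow_anti (ρ : Gauge) (ε : Idx) {m n : ℕ} (h : m ≤ n) : ρ ε ^ n ≤ ρ ε ^ m :=
  pow_le_pow_of_le_one (ρ.pos ε).le (ρ.le_one ε) h

theorem Gauge.isModerate_pow (ρ : Gauge) (S : Set Idx) (R : ℕ) :
    IsModerate ρ S fun ε => ρ ε ^ R := by
  refine ⟨0, Eventually.of_forall fun ε _ => ?_⟩
  rw [Real.norm_of_nonneg (pow_nonneg (ρ.pos ε).le _)]
  simpa using pow_le_one₀ (ρ.pos ε).le (ρ.le_one ε)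

theorem IsRep.eq {𝕜 : Type} [NormedField 𝕜] {S : Set Idx} {x : Idx → 𝕜}
    {a b : GenNum 𝕜 ρ S} (ha : IsRep x a) (hb : IsRep x b) : a = b := by
  obtain ⟨_, rfl⟩ := ha
  obtain ⟨_, rfl⟩ := hb
  rfl

theorem IsRep.restrict {𝕜 : Type} [NormedField 𝕜] {x : Idx → 𝕜} {a : GenNum 𝕜 ρ Set.univ}
    (hx : IsRep x a) (L : Set Idx) : IsRep x (GenNum.restrict L a) := by
  obtain ⟨hx, rfl⟩ := hx
  obtain ⟨N, hN⟩ := id hx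
  exact ⟨⟨N, hN.mono fun _ h _ => h trivial⟩, rfl⟩

theorem IsRep.eq_zero {𝕜 : Type} [NormedField 𝕜] {S : Set Idx} {x : Idx → 𝕜}
    {a : GenNum 𝕜 ρ S} (hx : IsRep x a) (h : IsNegligible ρ S x) : a = 0 := by
  refine hx.eq (isRep_zero.of_negligible_sub hx.1 ?_)
  intro q
  simpa using h q

theorem IsRep.isNegligible {𝕜 : Type} [NormedField 𝕜] {S : Set Idx} {x : Idx → 𝕜}
    (hx : IsRep x (0 : GenNum 𝕜 ρ S)) : IsNegligible ρ S x := by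
  simpa using hx.negligible_sub isRep_zero

theorem isNegligible_sum {ι 𝕜 : Type} [NormedField 𝕜] {S : Set Idx} {s : Finset ι}
    {x : ι → Idx → 𝕜} (h : ∀ i ∈ s, IsNegligible ρ S (x i)) :
    IsNegligible ρ S (∑ i ∈ s, x i) := by
  classical
  induction s using Finset.induction_on with
  | empty =>
    intro q
    exact Eventually.of_forall fun ε _ => by simpa using (pow_pos (ρ.pos ε) q).le
  | insert i s hi ih =>
    rw [Finset.sum_insert hi]
    exact (h i (Finset.mem_insert_self i s)).add
      (ih fun j hj => h j (Finset.mem_insert_of_mem hj))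

/-- The generalized number `[ρ_ε ^ R]`. -/
noncomputable def Gauge.genPow (ρ : Gauge) (R : ℕ) : RCReal ρ :=
  GenNum.mk ⟨fun ε => ρ ε ^ R, ρ.isModerate_pow _ R⟩

theorem Gauge.isRep_genPow (ρ : Gauge) (R : ℕ) : IsRep (fun ε => ρ ε ^ R) (ρ.genPow R) :=
  ⟨_, rfl⟩

theorem Gauge.genPow_pos (ρ : Gauge) (R : ℕ) : 0 < ρ.genPow R := by
  refine ⟨⟨0, _, isRep_zero, ρ.isRep_genPow R, ?_⟩, ?_⟩
  · exact Eventually.of_forall fun ε _ => (pow_pos (ρ.pos ε) R).le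
  · rw [sub_zero]
    exact (ρ.isRep_genPow R).isUnit (q := R) (Eventually.of_forall fun ε _ => le_abs_self _)

/-- The order holds for some representatives only. Passing to the given ones costs two negligible
errors, each at most `ρ ^ R / 4`; the spare factor `ρ ≤ 1 / 2` in the radius makes room for both. -/
theorem eventually_norm_sub_le_of_mem_sharpBall {z₀ z : RCComplex ρ} {R : ℕ}
    (hz : z ∈ sharpBall z₀ (ρ.genPow (R + 1))) {c d : Idx → ℂ} (hc : IsRep c z₀)
    (hd : IsRep d z) : ∀ᶠ ε in atBot, ‖d ε - c ε‖ ≤ ρ ε ^ R := by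
  obtain ⟨⟨a, b, ha, hb, hab⟩, -⟩ := hz
  filter_upwards [hab, (isRep_sub hd hc).abs.negligible_sub ha (R + 2),
    hb.negligible_sub (ρ.isRep_genPow (R + 1)) (R + 2), ρ.eventually_le_half] with ε h1 h2 h3 h4
  have h1 := h1 trivial
  have h2 := h2 trivial
  have h3 := h3 trivial
  simp only [Pi.sub_apply, Real.norm_eq_abs, abs_le] at h2 h3
  have hp := pow_pos (ρ.pos ε) R
  have h5 : ρ ε ^ (R + 2) ≤ 1 / 4 * ρ ε ^ R := by
    have h7 : ρ ε ^ 2 ≤ 1 / 4 := by nlinarith [ρ.pos ε]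
    rw [pow_add]; nlinarith
  have h6 : ρ ε ^ (R + 1) ≤ 1 / 2 * ρ ε ^ R := by
    rw [pow_succ]; nlinarith
  linarith

/-- Nets that are close enough to a representative of a point of a sharply open set represent
points of that set. -/
theorem IsSharplyOpen.exists_isRep_of_norm_sub_le {U : Set (RCComplex ρ)}
    (hU : IsSharplyOpen U) {z : RCComplex ρ} (hz : z ∈ U) {c : Idx → ℂ} (hc : IsRep c z) :
    ∃ q : ℕ, ∀ d : Idx → ℂ, (∀ᶠ ε in atBot, ‖d ε - c ε‖ ≤ ρ ε ^ q) →
      ∃ w ∈ U, IsRep d w := by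
  obtain ⟨r, hr, hrU⟩ := hU z hz
  obtain ⟨x, hx⟩ := exists_isRep r
  obtain ⟨q, hq⟩ := hx.pos_lower_bound hr
  -- The extra power of `ρ` keeps `r - |w - z|` above `ρ ^ (q + 1)`, hence invertible, as strict
  -- inequality demands.
  refine ⟨q + 1, fun d hd => ?_⟩
  have hdc : IsModerate ρ Set.univ (d - c) := by
    refine ⟨0, hd.mono fun ε hε _ => ?_⟩
    simpa using hε.trans (pow_le_one₀ (ρ.pos ε).le (ρ.le_one ε))
  have hdm : IsModerate ρ Set.univ d := by simpa using hdc.add hc.1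
  refine ⟨GenNum.mk ⟨d, hdm⟩, hrU ?_, hdm, rfl⟩
  have h1 : IsRep (fun ε => ‖(d - c) ε‖) (GenNum.mk ⟨d, hdm⟩ - z).abs :=
    (isRep_sub ⟨hdm, rfl⟩ hc).abs
  refine ⟨⟨_, _, h1, hx, ?_⟩, (isRep_sub hx h1).isUnit (q := q + 1) ?_⟩
  · filter_upwards [hq, hd] with ε h h' _
    exact h'.trans ((ρ.pow_anti ε (by omega)).trans h)
  · filter_upwards [hq, hd, ρ.eventually_le_half] with ε h h2 h' _
    refine le_trans ?_ (le_abs_self _)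
    have hp := pow_pos (ρ.pos ε) q
    rw [pow_succ] at h2 ⊢
    simp only [Pi.sub_apply] at h2 ⊢
    nlinarith

/-- The members of a defining net are bounded by a common power of `ρ` on balls whose radius is
a power of `ρ`. -/
theorem IsDefiningNet.exists_uniform_bound {U : Set (RCComplex ρ)} (hU : IsSharplyOpen U)
    {f : U → RCComplex ρ} {Ω : Idx → Set ℂ} {F : Idx → ℂ → ℂ} (hF : IsDefiningNet f Ω F)
    (z : U) {c : Idx → ℂ} (hc : IsRep c (z : RCComplex ρ)) :
    ∃ q N : ℕ, ∀ᶠ ε in atBot, Metric.closedBall (c ε) (ρ ε ^ q) ⊆ Ω ε ∧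
      ∀ w ∈ Metric.closedBall (c ε) (ρ ε ^ q), ‖F ε w‖ ≤ (ρ ε ^ N)⁻¹ := by
  obtain ⟨q₁, hq₁⟩ := hU.uniform z.2 hc
  obtain ⟨q₂, hq₂⟩ := hU.exists_isRep_of_norm_sub_le z.2 hc
  have hsub : ∀ᶠ ε in atBot, Metric.closedBall (c ε) (ρ ε ^ max q₁ q₂) ⊆ Ω ε := by
    filter_upwards [hq₁ (fun ε w => w ∈ Ω ε) fun w hw d hd => hF.mem ⟨w, hw⟩ d hd] with ε h w hw
    exact h w ((mem_closedBall_iff_norm.1 hw).trans (ρ.pow_anti ε (le_max_left _ _)))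
  -- Moderateness gives an exponent for each point separately. Maximizers of `‖F ε‖` on the discs
  -- form a net that itself represents a point of `U`, and its exponent serves the whole disc.
  have hmax : ∀ ε, ∃ w, Metric.closedBall (c ε) (ρ ε ^ max q₁ q₂) ⊆ Ω ε →
      w ∈ Metric.closedBall (c ε) (ρ ε ^ max q₁ q₂) ∧
        ∀ v ∈ Metric.closedBall (c ε) (ρ ε ^ max q₁ q₂), ‖F ε v‖ ≤ ‖F ε w‖ := by
    intro ε
    by_cases h : Metric.closedBall (c ε) (ρ ε ^ max q₁ q₂) ⊆ Ω ε
    · obtain ⟨w, hw, hw'⟩ := (isCompact_closedBall (c ε) (ρ ε ^ max q₁ q₂)).exists_isMaxOn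
        ⟨c ε, Metric.mem_closedBall_self (pow_pos (ρ.pos ε) _).le⟩
        ((hF.holomorphic ε).mono h).continuousOn.norm
      exact ⟨w, fun _ => ⟨hw, fun v hv => hw' hv⟩⟩
    · exact ⟨0, fun h' => absurd h' h⟩
  choose d hd using hmax
  obtain ⟨w, hwU, hw⟩ := hq₂ d (by
    filter_upwards [hsub] with ε h
    exact (mem_closedBall_iff_norm.1 (hd ε h).1).trans (ρ.pow_anti ε (le_max_right _ _)))
  obtain ⟨N, hN⟩ := (hF.value ⟨w, hwU⟩ d hw).1
  refine ⟨max q₁ q₂, N, ?_⟩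
  filter_upwards [hsub, hN] with ε h h'
  exact ⟨h, fun v hv => ((hd ε h).2 v hv).trans (h' trivial)⟩

end Nets

/-! ### Dominance of the leading Taylor term -/

section LowerBound

/-- If the first Taylor coefficients of `F` at `c` are small compared with the `n`-th one, then
`F` is bounded below away from `c`. -/
theorem le_norm_of_le_norm_iteratedDeriv {F : ℂ → ℂ} {Ω : Set ℂ} (hF : DifferentiableOn ℂ F Ω)
    {c w : ℂ} {s M δ η : ℝ} (hs : 0 < s) (hΩ : Metric.closedBall c s ⊆ Ω)
    (hM : ∀ v ∈ Metric.closedBall c s, ‖F v‖ ≤ M) {n : ℕ}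
    (hδ : δ ≤ ‖iteratedDeriv n F c‖)
    (hη : ∑ k ∈ Finset.range n, ‖iteratedDeriv k F c‖ ≤ η)
    (hw : ‖w - c‖ / s ≤ 1 / 2) (hw1 : ‖w - c‖ ≤ 1)
    (hsmall : 4 * n.factorial * M * ‖w - c‖ ≤ δ * s ^ (n + 1)) :
    δ * ‖w - c‖ ^ n / (2 * n.factorial) - η ≤ ‖F w‖ := by
  have h := norm_taylor_sub_le hF hs hΩ hM hw (n + 1)
  rw [Finset.sum_range_succ] at h
  set A := ∑ k ∈ Finset.range n, (k.factorial : ℂ)⁻¹ * (w - c) ^ k * iteratedDeriv k F c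
  set B := (n.factorial : ℂ)⁻¹ * (w - c) ^ n * iteratedDeriv n F c with hB
  have hn : (0 : ℝ) < n.factorial := by positivity
  have hA : ‖A‖ ≤ η := by
    refine (norm_sum_le _ _).trans (le_trans (Finset.sum_le_sum fun k _ => ?_) hη)
    rw [norm_mul, norm_mul, norm_inv, norm_pow, Complex.norm_natCast]
    have hk : (k.factorial : ℝ)⁻¹ ≤ 1 :=
      inv_le_one_of_one_le₀ (by exact_mod_cast k.factorial_pos)
    exact mul_le_of_le_one_left (norm_nonneg _)
      (mul_le_one₀ hk (by positivity) (pow_le_one₀ (norm_nonneg _) hw1))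
  have hBn : δ * ‖w - c‖ ^ n / n.factorial ≤ ‖B‖ := by
    rw [hB, norm_mul, norm_mul, norm_inv, norm_pow, Complex.norm_natCast]
    calc δ * ‖w - c‖ ^ n / n.factorial
        = (n.factorial : ℝ)⁻¹ * ‖w - c‖ ^ n * δ := by field_simp
      _ ≤ _ := by gcongr
  -- `hsmall` times `‖w - c‖ ^ n`: the remainder takes at most half of the leading term.
  have hrem : 2 * M * (‖w - c‖ / s) ^ (n + 1) ≤ δ * ‖w - c‖ ^ n / (2 * n.factorial) := by
    rw [div_pow, le_div_iff₀ (by positivity), ← mul_div_assoc, div_mul_eq_mul_div,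
      div_le_iff₀ (by positivity), pow_succ ‖w - c‖]
    have := mul_le_mul_of_nonneg_left hsmall (pow_nonneg (norm_nonneg (w - c)) n)
    linarith
  have htri : ‖B‖ ≤ ‖A + B - F w‖ + ‖A‖ + ‖F w‖ := by
    have : B = (A + B - F w) - A + F w := by ring
    calc ‖B‖ = ‖(A + B - F w) - A + F w‖ := by rw [← this]
      _ ≤ _ := (norm_add_le _ _).trans (by gcongr; exact norm_sub_le _ _)
  have hhalf : δ * ‖w - c‖ ^ n / n.factorial
      = δ * ‖w - c‖ ^ n / (2 * n.factorial) + δ * ‖w - c‖ ^ n / (2 * n.factorial) := by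
    field_simp; ring
  linarith

end LowerBound

end RobinsonColombeau

/-! ### Invertibility near the zero along a subpoint -/

theorem mainTheorem5 (ρ : RobinsonColombeau.Gauge)
    (U : Set (RobinsonColombeau.RCComplex ρ)) (hU : RobinsonColombeau.IsSharplyOpen U)
    (z₀ : U) (f : U → RobinsonColombeau.RCComplex ρ) (hf : RobinsonColombeau.IsGHF f)
    (hzero : f z₀ = 0) (hderiv : ∃ n : ℕ, 0 < n ∧ hf.iteratedDeriv n z₀ ≠ 0) :
    ∃ L : Set RobinsonColombeau.Idx, RobinsonColombeau.IsSubpoint L ∧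
      ∃ r : RobinsonColombeau.RCReal ρ, 0 < r ∧
        ∃ hB : RobinsonColombeau.sharpBall (z₀ : RobinsonColombeau.RCComplex ρ) r ⊆ U,
          ∀ (z : RobinsonColombeau.RCComplex ρ)
            (hz : z ∈ RobinsonColombeau.sharpBall (z₀ : RobinsonColombeau.RCComplex ρ) r),
            0 < (z - (z₀ : RobinsonColombeau.RCComplex ρ)).abs →
              IsUnit (RobinsonColombeau.GenNum.restrict L (f ⟨z, hB hz⟩)) := by
  classical
  set n := Nat.find hderiv with hn
  obtain ⟨hn0, hne⟩ : 0 < n ∧ hf.iteratedDeriv n z₀ ≠ 0 := Nat.find_spec hderiv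
  obtain ⟨Ω, F, hF⟩ := id hf
  obtain ⟨c, hc⟩ := RobinsonColombeau.exists_isRep (z₀ : RobinsonColombeau.RCComplex ρ)
  have hder := fun k => hf.isRep_iteratedDeriv hU hF k z₀ hc
  -- Order `0` is negligible by `hzero`, the orders between by minimality of `n`.
  have hlow : ∀ k ∈ Finset.range n, RobinsonColombeau.IsNegligible ρ Set.univ
      fun ε => ‖iteratedDeriv k (F ε) (c ε)‖ := by
    intro k hk
    have h : RobinsonColombeau.IsNegligible ρ Set.univ
        fun ε => iteratedDeriv k (F ε) (c ε) := by
      rcases Nat.eq_zero_or_pos k with rfl | hk0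
      · have := hF.value z₀ c hc
        rw [hzero] at this
        simpa using this.isNegligible
      · have := Nat.find_min hderiv (Finset.mem_range.1 hk)
        have h0 : hf.iteratedDeriv k z₀ = 0 := by
          by_contra h0
          exact this ⟨hk0, h0⟩
        exact (h0 ▸ hder k).isNegligible
    intro q
    simpa using h q
  have hsum := RobinsonColombeau.isNegligible_sum hlow
  have hnn : ¬ RobinsonColombeau.IsNegligible ρ Set.univ
      fun ε => iteratedDeriv n (F ε) (c ε) := fun h => hne ((hder n).eq_zero h)
  simp only [RobinsonColombeau.IsNegligible, not_forall] at hnn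
  obtain ⟨p, hp⟩ := hnn
  obtain ⟨q, N, hqN⟩ := hF.exists_uniform_bound hU z₀ hc
  obtain ⟨q', hq'⟩ := hU.exists_isRep_of_norm_sub_le z₀.2 hc
  -- `q'` keeps the ball in `U`. The other exponent yields `4 n! M ‖w - c‖ ≤ δ s ^ (n + 1)` for `M =
  -- ρ ^ (-N)`, `δ = ρ ^ p`, `s = ρ ^ q`; its final `+ 1` absorbs `4 n!`.
  set R := max q' (N + p + q * (n + 1) + 1) with hR
  have hball : RobinsonColombeau.sharpBall (z₀ : RobinsonColombeau.RCComplex ρ)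
      (ρ.genPow (R + 1)) ⊆ U := by
    intro z hz
    obtain ⟨d, hd⟩ := RobinsonColombeau.exists_isRep z
    obtain ⟨w, hw, hdw⟩ := hq' d (by
      filter_upwards [RobinsonColombeau.eventually_norm_sub_le_of_mem_sharpBall hz hc hd] with ε h
      exact h.trans (ρ.pow_anti ε (le_max_left _ _)))
    exact hd.eq hdw ▸ hw
  refine ⟨{ε | ρ ε ^ p ≤ ‖iteratedDeriv n (F ε) (c ε)‖}, ?_, ρ.genPow (R + 1),
    ρ.genPow_pos _, hball, fun z hz hpos => ?_⟩
  · refine (Filter.not_eventually.1 hp).mono fun ε h => ?_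
    simp only [Set.mem_univ, forall_const, not_le] at h
    exact h.le
  obtain ⟨d, hd⟩ := RobinsonColombeau.exists_isRep z
  obtain ⟨m, hm⟩ := (RobinsonColombeau.isRep_sub hd hc).abs.pos_lower_bound hpos
  -- The leading half-term is at least `ρ ^ (p + m * n) / (2 n!)`, hence at least `2 ρ ^ (p + m * n
  -- + 1)`; the low-order part is at most `ρ ^ (p + m * n + 2)`.
  refine ((hF.value ⟨z, hball hz⟩ d hd).restrict _).isUnit (q := p + m * n + 2) ?_
  filter_upwards [hqN, hm, hsum (p + m * n + 2), ρ.eventually_le_half,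
    RobinsonColombeau.eventually_norm_sub_le_of_mem_sharpBall hz hc hd,
    ρ.eventually_const_mul_le_one (4 * n.factorial)] with ε h1 h2 h3 h4 h5 h6 hL
  have hρ := ρ.pos ε
  have hpq := pow_pos hρ q
  have hpN := pow_pos hρ N
  have h3 := h3 trivial
  simp only [Finset.sum_apply, Real.norm_eq_abs] at h3
  simp only [Pi.sub_apply] at h2
  have h7 : ‖d ε - c ε‖ ≤ ρ ε ^ (N + p + q * (n + 1) + 1) :=
    h5.trans (ρ.pow_anti ε (le_max_right _ _))
  -- One power beyond the disc radius `ρ ^ q` makes the ratio at most `ρ ≤ 1 / 2`.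
  have h8 : ‖d ε - c ε‖ ≤ ρ ε ^ (q + 1) := h7.trans (ρ.pow_anti ε (by nlinarith))
  have hfac : (0 : ℝ) < n.factorial := by positivity
  refine le_trans ?_ (RobinsonColombeau.le_norm_of_le_norm_iteratedDeriv (hF.holomorphic ε) hpq
    h1.1 h1.2 hL ((le_abs_self _).trans h3) ?_ (h8.trans (pow_le_one₀ hρ.le (ρ.le_one ε))) ?_)
  · have h9 : ρ ε ^ (p + m * n) ≤ ρ ε ^ p * ‖d ε - c ε‖ ^ n := by
      rw [pow_add, pow_mul]
      gcongr
    have h10 : ρ ε ^ (p + m * n + 1) * 2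
        ≤ ρ ε ^ p * ‖d ε - c ε‖ ^ n / (2 * n.factorial) := by
      rw [le_div_iff₀ (by positivity)]
      have h11 := mul_le_mul_of_nonneg_left h6 (pow_pos hρ (p + m * n)).le
      rw [pow_succ]
      linarith
    have h12 : ρ ε ^ (p + m * n + 2) ≤ ρ ε ^ (p + m * n + 1) := ρ.pow_anti ε (by omega)
    linarith
  · rw [div_le_iff₀ hpq]
    rw [pow_succ] at h8
    nlinarith
  · calc 4 * n.factorial * (ρ ε ^ N)⁻¹ * ‖d ε - c ε‖
        ≤ 4 * n.factorial * (ρ ε ^ N)⁻¹ * ρ ε ^ (N + p + q * (n + 1) + 1) := by gcongr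
      _ = 4 * n.factorial * ρ ε * (ρ ε ^ p * (ρ ε ^ q) ^ (n + 1)) := by
        rw [← pow_mul, pow_succ, pow_add, pow_add]
        field_simp
      _ ≤ 1 * (ρ ε ^ p * (ρ ε ^ q) ^ (n + 1)) := by gcongr
      _ = _ := one_mul _
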